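/- Let $L\ge 4$ be even, and let $G=(V,E)$ be the $L\times L$ toric grid: $V=\{1,\dots,L\}^2$, and two nodes are adjacent if they differ by $1 \pmod L$ in exactly one coordinate. Let $\Omega$ be the set of independent sets of $G$, seen as $0/1$-vectors; node $i$ is unblocked in $x\in\Omega$ if neither $i$ nor any of its neighbors is active ($x_j=1$) in $x$. Let $\lambda,\mu,\nu>0$ and $0<p\le 1$, and let $(X(t),Q(t))_{t\ge0}$ be the continuous-time Markov process on $\Omega\times\mathbb N^{V}$ with the following transitions from $(X,Q)$, for each node $i$ (with $e_i$ the $i$-th unit vector): to $(X,Q+e_i)$ at rate $\lambda$ (arrival of a packet); if $i$ is unblocked, to $(X+e_i,\,Q-e_i\mathbf 1\{Q_i>0\})$ at rate $\nu$ (activation); if $X_i=1$, to $(X-e_i,Q)$ at rate $p\mu$ (end of a transmission, followed by a back-off) and to $(X,\,Q-e_i\mathbf 1\{Q_i>0\})$ at rate $(1-p)\mu$ (end of a transmission, immediately followed by the next one). Put $\rho = 2\lambda/\mu$ (the normalized load) and $\sigma=\nu/(p\mu)$. Call the queue at node $i$ stable if the queue-length process $Q_i(t)$, with its modulating activity process,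 is positive recurrent, that is, if for every state $(x,k)\in\Omega\times\mathbb N$ the process $(X(t),Q_i(t))$ started in $(x,k)$ has a finite mean time of first return to $(x,k)$ after having left it. If the queues at all nodes are stable, then $$\rho<1\qquad\text{and}\qquad \sigma>\frac{\rho}{2(1-\rho)} .$$ -/

import Mathlib

open MeasureTheory ProbabilityTheory
open scoped ENNReal NNReal

noncomputable section

namespace RandomAccess

/-- A random-access network on the vertex set `V`: conflict graph, arrival rates, transmission
rates, back-off rates and back-off probabilities of the nodes. -/
structure Network (V : Type) where
  /-- conflict graph -/
  graph : SimpleGraph V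
  /-- packet arrival rates -/
  lam : V → ℝ
  /-- transmission rates (mean transmission time `1 / mu i`) -/
  mu : V → ℝ
  /-- back-off rates (mean back-off period `1 / nu i`) -/
  nu : V → ℝ
  /-- probability of starting a back-off period after a transmission -/
  p : V → ℝ
  lam_pos : ∀ i, 0 < lam i
  mu_pos : ∀ i, 0 < mu i
  nu_pos : ∀ i, 0 < nu i
  p_pos : ∀ i, 0 < p i
  p_le_one : ∀ i, p i ≤ 1

/-- The four kinds of events that change (or may change) the state. -/
inductive Event (V : Type) where
  /-- a packet arrives at node `i` -/
  | arrival (i : V)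
  /-- the back-off of node `i` ends and `i` becomes active -/
  | activation (i : V)
  /-- node `i` completes a transmission and goes into back-off -/
  | backoff (i : V)
  /-- node `i` completes a transmission and immediately starts the next one -/
  | nextTransmission (i : V)

/-- An event is a node together with one of four kinds. -/
def Event.equiv (V : Type) : Event V ≃ ((V ⊕ V) ⊕ (V ⊕ V)) where
  toFun
    | .arrival i => .inl (.inl i)
    | .activation i => .inl (.inr i)
    | .backoff i => .inr (.inl i)
    | .nextTransmission i => .inr (.inr i)
  invFun
    | .inl (.inl i) => .arrival i
    | .inl (.inr i) => .activation i
    | .inr (.inl i) => .backoff i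
    | .inr (.inr i) => .nextTransmission i
  left_inv e := by cases e <;> rfl
  right_inv s := by rcases s with (i | i) | (i | i) <;> rfl

instance (V : Type) [Fintype V] : Fintype (Event V) := Fintype.ofEquiv _ (Event.equiv V).symm

namespace Network

variable {V : Type} (N : Network V)

/-- The feasible joint activity states: sets of active nodes that are independent in the
conflict graph. -/
def Activity : Type := {x : Finset V // N.graph.IsIndepSet (x : Set V)}

instance [Finite V] : Finite N.Activity := by
  unfold Activity; infer_instance

instance : MeasurableSpace N.Activity := ⊤

instance : DiscreteMeasurableSpace N.Activity := ⟨fun _ => trivial⟩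

/-- Joint states `(X, Q)`: activity state and queue lengths. -/
abbrev State : Type := N.Activity × (V → ℕ)

/-- A node is unblocked if neither the node itself nor any of its neighbors is active. -/
def Unblocked (x : N.Activity) (i : V) : Prop :=
  i ∉ x.1 ∧ ∀ j ∈ x.1, ¬ N.graph.Adj i j

/-- Sample points of the process: the sequence of (state, holding time in that state). -/
abbrev Sample : Type := ℕ → N.State × ℝ

variable {N}

/-- The `n`-th event epoch: the sum of the first `n` holding times. -/
def epoch (ω : N.Sample) (n : ℕ) : ℝ≥0∞ := ∑ k ∈ Finset.range n, ENNReal.ofReal (ω k).2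

/-- The process is in state `z` at time `t`: `(X(t), Q(t)) = z`. -/
def IsAt (ω : N.Sample) (t : ℝ≥0) (z : N.State) : Prop :=
  ∃ n, epoch ω n ≤ t ∧ t < epoch ω (n + 1) ∧ (ω n).1 = z

/-- For a process that starts in `B`: the first time at which it is back in `B` after having
left `B` (infinite if there is none). -/
def returnTime (B : Set N.State) (ω : N.Sample) : ℝ≥0∞ :=
  ⨅ (t : ℝ≥0) (_ : (∃ z ∈ B, IsAt ω t z) ∧ ∃ s < t, ∃ z ∉ B, IsAt ω s z), (t : ℝ≥0∞)

variable (N)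

variable [DecidableEq V]

/-- Activity state after the activation of an unblocked node. -/
def activate (x : N.Activity) (i : V) (h : N.Unblocked x i) : N.Activity :=
  ⟨insert i x.1, by
    rw [Finset.coe_insert]
    exact Set.Pairwise.insert x.2 fun j hj _ => ⟨h.2 j hj, fun e => h.2 j hj e.symm⟩⟩

/-- Activity state after the deactivation of a node. -/
def deactivate (x : N.Activity) (i : V) : N.Activity :=
  ⟨x.1.erase i, Set.Pairwise.mono (by simp) x.2⟩

/-- `Q + e_i`. -/
def addPacket (Q : V → ℕ) (i : V) : V → ℕ := Function.update Q i (Q i + 1)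

/-- `Q - e_i 1{Q_i > 0}` (truncated subtraction). -/
def removePacket (Q : V → ℕ) (i : V) : V → ℕ := Function.update Q i (Q i - 1)

open Classical in
/-- The rate at which an event occurs in a state. -/
def rate (z : N.State) : Event V → ℝ
  | .arrival i => N.lam i
  | .activation i => if N.Unblocked z.1 i then N.nu i else 0
  | .backoff i => if i ∈ z.1.1 then N.p i * N.mu i else 0
  | .nextTransmission i => if i ∈ z.1.1 then (1 - N.p i) * N.mu i else 0

open Classical in
/-- The state after an event (unchanged if the activity state does not permit the event).
If `Q_i = 0`, then a transmission of node `i` that is followed immediately by another one leaves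
the state as it is. -/
def next (z : N.State) : Event V → N.State
  | .arrival i => (z.1, addPacket z.2 i)
  | .activation i =>
      if h : N.Unblocked z.1 i then (N.activate z.1 i h, removePacket z.2 i) else z
  | .backoff i => if i ∈ z.1.1 then (N.deactivate z.1 i, z.2) else z
  | .nextTransmission i => if i ∈ z.1.1 then (z.1, removePacket z.2 i) else z

theorem rate_nonneg (z : N.State) (e : Event V) : 0 ≤ N.rate z e := by
  cases e with
  | arrival i => exact (N.lam_pos i).le
  | activation i =>
    simp only [rate]; split_ifs
    exacts [(N.nu_pos i).le, le_rfl]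
  | backoff i =>
    simp only [rate]; split_ifs
    exacts [(mul_pos (N.p_pos i) (N.mu_pos i)).le, le_rfl]
  | nextTransmission i =>
    simp only [rate]; split_ifs
    exacts [mul_nonneg (sub_nonneg.2 (N.p_le_one i)) (N.mu_pos i).le, le_rfl]

variable [Fintype V]

/-- Total event rate in a state. -/
def totalRate (z : N.State) : ℝ := ∑ e, N.rate z e

theorem totalRate_pos [Nonempty V] (z : N.State) : 0 < N.totalRate z := by
  refine Finset.sum_pos' (fun e _ => N.rate_nonneg z e) ?_
  exact ⟨.arrival (Classical.arbitrary V), Finset.mem_univ _, N.lam_pos _⟩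

/-- A state `z` together with an exponential holding time of rate `totalRate z`. -/
def withHoldingTime (z : N.State) : Measure (N.State × ℝ) :=
  (Measure.dirac z).prod (expMeasure (N.totalRate z))

/-- Law of the next state and its holding time: the event `e` is the next one with probability
`rate z e / totalRate z`. -/
def step (z : N.State) : Measure (N.State × ℝ) :=
  ∑ e, ENNReal.ofReal (N.rate z e / N.totalRate z) • N.withHoldingTime (N.next z e)

variable [Nonempty V]

instance (z : N.State) : IsProbabilityMeasure (N.withHoldingTime z) := by
  have := isProbabilityMeasure_expMeasure (N.totalRate_pos z)
  unfold withHoldingTime; infer_instance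

instance (z : N.State) : IsProbabilityMeasure (N.step z) := by
  constructor
  have hq := N.totalRate_pos z
  simp only [step, Measure.coe_finsetSum, Finset.sum_apply, Measure.smul_apply, measure_univ,
    smul_eq_mul, mul_one]
  rw [← ENNReal.ofReal_sum_of_nonneg fun e _ => div_nonneg (N.rate_nonneg z e) hq.le,
    ← Finset.sum_div]
  have : ∑ e, N.rate z e = N.totalRate z := rfl
  rw [this, div_self hq.ne', ENNReal.ofReal_one]

/-- The transition kernel of the chain (state, holding time in that state): its `n`-th step
depends on the past only through the `n`-th state. -/
def stepKernel (n : ℕ) : Kernel ((_ : Finset.Iic n) → N.State × ℝ) (N.State × ℝ) :=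
  (Kernel.ofFunOfCountable N.step).comap (fun h => (h ⟨n, Finset.mem_Iic.2 le_rfl⟩).1)
    (by fun_prop)

instance (n : ℕ) : IsMarkovKernel (N.stepKernel n) := by
  have : IsMarkovKernel (Kernel.ofFunOfCountable N.step) :=
    ⟨fun z => inferInstanceAs (IsProbabilityMeasure (N.step z))⟩
  unfold stepKernel; infer_instance

/-- The law of the continuous-time Markov process `(X(t), Q(t))` started in `z`, through its
jump-chain and holding-time construction. -/
def law (z : N.State) : Measure N.Sample :=
  Kernel.trajMeasure (X := fun _ => N.State × ℝ) (N.withHoldingTime z) N.stepKernel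

/-- Stability of the queue at node `i`, that is, positive recurrence of the queue-length process
`Q_i(t)`. This process is modulated by the activity process, and `(X(t), Q_i(t))` is a Markov
process (a quasi-birth-and-death process): the mean return time of `(X(t), Q_i(t))` to each of its
states `(x, k)`, after having left it, is finite. -/
def QueueStable (i : V) : Prop :=
  ∀ z : N.State, ∫⁻ ω, returnTime {y | y.1 = z.1 ∧ y.2 i = z.2 i} ω ∂(N.law z) < ∞

end Network

/-- The `L × L` toric grid: nodes are adjacent if they differ by `1` modulo `L` in exactly one
coordinate. -/
def toricGrid (L : ℕ) : SimpleGraph (Fin L × Fin L) :=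
  SimpleGraph.boxProd (SimpleGraph.cycleGraph L) (SimpleGraph.cycleGraph L)

/-- The symmetric network on the toric grid, with the same rates at all nodes. -/
def toricNetwork (L : ℕ) (lam mu nu p : ℝ) (hlam : 0 < lam) (hmu : 0 < mu) (hnu : 0 < nu)
    (hp : 0 < p) (hp1 : p ≤ 1) : Network (Fin L × Fin L) where
  graph := toricGrid L
  lam _ := lam
  mu _ := mu
  nu _ := nu
  p _ := p
  lam_pos _ := hlam
  mu_pos _ := hmu
  nu_pos _ := hnu
  p_pos _ := hp
  p_le_one _ := hp1

end RandomAccess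

end

/-! Let θ_i be the stationary probability that node i is active. The activity process does not see
the queues; it is reversible, and the weight of a state is the product of ν/(pμ) over its active
nodes. Balance of activations and back-offs gives P(i unblocked) = θ_i/σ, so queue i, if never
empty, would be served at mean rate νθ_i/σ + (1-p)μθ_i = μθ_i. Stability therefore forces λ ≤ μθ_i,
that is ρ/2 ≤ θ_i (`QueueStable.lam_mul_le`).

For adjacent i and j, the events "i active", "j active" and "i unblocked" are disjoint, and they
miss the state in which only another neighbor of i is active. Hence θ_i + θ_j + θ_i/σ < 1
(`activeWeight_add_lt`), and so ρ + ρ/(2σ) < 1, which contains both claims. As this inequality is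
strict, the critical case λ = μθ_i of the stability bound need not be excluded.

The bound λ ≤ μθ_i is proved by contradiction. If λ > μθ_i, a solution h of the Poisson equation for
the activity process (`exists_generator_eq`) turns Q_i + h(X) into a function with bounded jumps and
drift at least λ - μθ_i > 0 in every state. Such a drift is incompatible with a finite mean return
time (`lintegral_returnTime_eq_top`): stopping at the return shows that the probability of no return
within n steps is at least a constant over n, which is not summable. -/

noncomputable section

namespace RandomAccess

namespace Network

variable {V : Type} {N : Network V}

/-! ### Sample paths and one-step conditioning -/

/-- No return to `B` after an exit from `B` has happened during the first `k` steps. -/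
def notReturned (B : Set N.State) (k : ℕ) : Set N.Sample :=
  {ω | ∀ m n, m < n → n ≤ k → (ω m).1 ∉ B → (ω n).1 ∉ B}

theorem notReturned_anti (B : Set N.State) : Antitone (notReturned B) :=
  fun _ _ h _ hω m n hmn hn => hω m n hmn (hn.trans h)

theorem mem_notReturned_succ {B : Set N.State} {k : ℕ} {ω : N.Sample} :
    ω ∈ notReturned B (k + 1) ↔
      ω ∈ notReturned B k ∧ ((ω (k + 1)).1 ∈ B → ∀ m ≤ k, (ω m).1 ∈ B) := by
  constructor
  · refine fun h => ⟨notReturned_anti B k.le_succ h, fun hB m hm => ?_⟩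
    by_contra hc
    exact h m (k + 1) (by omega) le_rfl hc hB
  · rintro ⟨h1, h2⟩ m n hmn hn hm hn'
    rcases Nat.lt_or_ge k n with h | h
    · obtain rfl : n = k + 1 := by omega
      exact hm (h2 hn' m (by omega))
    · exact h1 m n hmn h hm hn'

theorem epoch_mono (ω : N.Sample) : Monotone (epoch ω) := fun _ _ h =>
  Finset.sum_le_sum_of_subset (Finset.range_subset_range.2 h)

/-- If the path is back in `B` at time t, during its b-th state, then `notReturned B k` fails for
all k ≥ b. Only holding times with index below b are counted, and they add up to `epoch ω b`, which
is at most t. -/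
theorem sum_notReturned_le_returnTime (B : Set N.State) (ω : N.Sample) (n : ℕ) :
    ∑ k ∈ Finset.range n, (notReturned B k).indicator (fun ω => ENNReal.ofReal (ω k).2) ω
      ≤ returnTime B ω := by
  refine le_iInf₂ fun t ht => ?_
  obtain ⟨⟨z, hz, b, hb1, hb2, hb3⟩, s, hst, y, hy, a, ha1, ha2, ha3⟩ := ht
  have hab : a < b := by
    have h1 : a < b + 1 := by
      by_contra hc
      exact absurd ((epoch_mono ω (not_lt.1 hc)).trans ha1)
        (not_le.2 ((ENNReal.coe_lt_coe.2 hst).trans hb2))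
    refine lt_of_le_of_ne (by omega) ?_
    rintro rfl
    exact hy (ha3 ▸ hb3.symm ▸ hz)
  have hnot : ∀ k, b ≤ k → ω ∉ notReturned B k := fun k hk h =>
    h a b hab hk (ha3 ▸ hy) (hb3 ▸ hz)
  refine le_trans ?_ hb1
  unfold epoch
  calc _ ≤ ∑ k ∈ Finset.range n with k < b, ENNReal.ofReal (ω k).2 := by
        rw [Finset.sum_filter]
        refine Finset.sum_le_sum fun k _ => ?_
        split_ifs with h
        · exact Set.indicator_le_self' (fun _ _ => zero_le) _
        · rw [Set.indicator_of_notMem (hnot k (not_lt.1 h))]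
    _ ≤ _ := Finset.sum_le_sum_of_subset fun k hk => by simp at hk ⊢; exact hk.2

theorem measurable_state (k : ℕ) : Measurable fun ω : N.Sample => (ω k).1 :=
  measurable_fst.comp (measurable_pi_apply k)

section
variable [Finite V]

instance : Countable N.State := by
  infer_instance

theorem measurableSet_state (k : ℕ) (B : Set N.State) :
    MeasurableSet {ω : N.Sample | (ω k).1 ∈ B} :=
  measurable_state k (Set.to_countable B).measurableSet

theorem measurableSet_notReturned (B : Set N.State) (k : ℕ) :
    MeasurableSet (notReturned B k) := by
  have : notReturned B k = ⋂ (m : ℕ) (n : ℕ) (_ : m < n) (_ : n ≤ k),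
      ({ω : N.Sample | (ω m).1 ∈ B} ∪ {ω | (ω n).1 ∈ Bᶜ}) := by
    ext ω
    simp only [notReturned, Set.mem_ofPred_eq, Set.mem_iInter, Set.mem_union, Set.mem_compl_iff]
    grind
  rw [this]
  exact .iInter fun m => .iInter fun n => .iInter fun _ => .iInter fun _ =>
    (measurableSet_state m B).union (measurableSet_state n _)

end

variable (N) [DecidableEq V] [Fintype V] [Nonempty V]

instance (z : N.State) : IsProbabilityMeasure (N.law z) := by
  have : ∀ n, IsMarkovKernel (N.stepKernel n) := fun n => inferInstance
  unfold law; infer_instance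

/-- One-step conditioning: a functional of the past and of the next state and holding time is
integrated by integrating the latter against `step`. -/
theorem lintegral_law_succ (z : N.State) (k : ℕ) (G : N.Sample → N.State × ℝ → ℝ≥0∞)
    (hG : Measurable (Function.uncurry G))
    (hdep : ∀ ω ω' : N.Sample, (∀ m ≤ k, ω m = ω' m) → G ω = G ω') :
    ∫⁻ ω, G ω (ω (k + 1)) ∂(N.law z) = ∫⁻ ω, ∫⁻ y, G ω y ∂(N.step (ω k).1) ∂(N.law z) := by
  -- A finite history is padded to a full sample by repeating its last entry; `hdep` makes the
  -- padding invisible to `G`.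
  let ext : ((i : Finset.Iic k) → N.State × ℝ) → N.Sample := fun h i =>
    if hi : i ≤ k then h ⟨i, Finset.mem_Iic.2 hi⟩ else h ⟨k, Finset.mem_Iic.2 le_rfl⟩
  have hext : Measurable ext := by
    refine measurable_pi_lambda _ fun i => ?_
    by_cases hi : i ≤ k
    · simp only [ext, hi, dif_pos]; fun_prop
    · simp only [ext, hi, dif_neg, not_false_eq_true]; fun_prop
  have hGe : ∀ ω : N.Sample, G (ext (Preorder.frestrictLe k ω)) = G ω := fun ω =>
    hdep _ _ fun m hm => by simp [ext, hm]
  have hM : Measurable (Function.uncurry fun h y => G (ext h) y) :=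
    hG.comp ((hext.comp measurable_fst).prodMk measurable_snd)
  have key := congrArg (fun μ => ∫⁻ q, (Function.uncurry fun h y => G (ext h) y) q ∂μ)
    (Kernel.map_frestrictLe_trajMeasure_compProd_eq_map_trajMeasure
      (X := fun _ => N.State × ℝ) (μ₀ := N.withHoldingTime z) (κ := N.stepKernel) (a := k))
  rw [Measure.lintegral_compProd hM, lintegral_map hM (by fun_prop),
    lintegral_map (Measurable.lintegral_kernel_prod_right' hM) (by fun_prop)] at key
  simp only [Function.uncurry, hGe] at key
  exact key.symm

theorem law_start (z : N.State) : ∀ᵐ ω ∂(N.law z), (ω 0).1 = z := by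
  have h0 : (N.law z).map (Preorder.frestrictLe 0) =
      (N.withHoldingTime z).map (MeasurableEquiv.piUnique
        (fun i : Finset.Iic 0 => N.State × ℝ)).symm := by
    unfold law Kernel.trajMeasure
    rw [Measure.map_comp _ _ (by fun_prop), Kernel.traj_map_frestrictLe, Kernel.partialTraj_self,
      Measure.id_comp]
  have h1 : ∀ᵐ y ∂(N.withHoldingTime z), y.1 = z := by
    have : (N.withHoldingTime z).map Prod.fst = Measure.dirac z := by
      have := isProbabilityMeasure_expMeasure (N.totalRate_pos z)
      unfold withHoldingTime
      rw [Measure.map_fst_prod]; simp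
    have h2 : ∀ᵐ y ∂((N.withHoldingTime z).map Prod.fst), y = z := by
      rw [this]; simp
    exact ae_of_ae_map (by fun_prop) h2
  have h2 : ∀ᵐ y ∂((N.law z).map (Preorder.frestrictLe 0)),
      (y ⟨0, Finset.mem_Iic.2 le_rfl⟩).1 = z := by
    rw [h0]
    rw [ae_map_iff (by fun_prop)]
    · exact h1
    · exact measurableSet_eq_fun (by fun_prop) (by fun_prop)
  exact ae_of_ae_map (by fun_prop) h2

theorem lintegral_step (z : N.State) (F : N.State × ℝ → ℝ≥0∞) (hF : Measurable F) :
    ∫⁻ y, F y ∂(N.step z) = ∑ e, ENNReal.ofReal (N.rate z e / N.totalRate z) *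
      ∫⁻ t, F (N.next z e, t) ∂(expMeasure (N.totalRate (N.next z e))) := by
  unfold step
  rw [lintegral_finsetSum_measure]
  refine Finset.sum_congr rfl fun e _ => ?_
  have := isProbabilityMeasure_expMeasure (N.totalRate_pos (N.next z e))
  rw [lintegral_smul_measure, withHoldingTime, lintegral_prod _ hF.aemeasurable, lintegral_dirac' _
    hF.lintegral_prod_right', smul_eq_mul]

theorem lintegral_step_state (z : N.State) (F : N.State → ℝ≥0∞) (hF : Measurable F) :
    ∫⁻ y, F y.1 ∂(N.step z) = ∑ e, ENNReal.ofReal (N.rate z e / N.totalRate z) *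
      F (N.next z e) := by
  rw [N.lintegral_step z (fun y => F y.1) (hF.comp measurable_fst)]
  refine Finset.sum_congr rfl fun e _ => ?_
  have := isProbabilityMeasure_expMeasure (N.totalRate_pos (N.next z e))
  simp

theorem law_next (z : N.State) : ∀ᵐ ω ∂(N.law z), ∀ n, ∃ e, (ω (n + 1)).1 = N.next (ω n).1 e := by
  rw [ae_all_iff]
  intro n
  let R : Set (N.State × N.State) := {q | ¬ ∃ e, q.2 = N.next q.1 e}
  have hR : MeasurableSet R := (Set.to_countable R).measurableSet
  have h := N.lintegral_law_succ z n (fun ω y => R.indicator 1 ((ω n).1, y.1))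
    ((measurable_one.indicator hR).comp
      (((measurable_state n).comp measurable_fst).prodMk (measurable_fst.comp measurable_snd)))
    (fun ω ω' h => by ext; simp only [h n le_rfl])
  have h0 : ∀ x : N.State, ∫⁻ y, R.indicator 1 (x, y.1) ∂(N.step x) = 0 := by
    intro x
    rw [N.lintegral_step_state x (fun y => R.indicator 1 (x, y))
      ((measurable_one.indicator hR).comp measurable_prodMk_left)]
    refine Finset.sum_eq_zero fun e _ => ?_
    rw [Set.indicator_of_notMem, mul_zero]
    simp [R]
  simp only [h0, lintegral_zero] at h
  have h' := (lintegral_eq_zero_iff ((measurable_one.indicator hR).comp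
      ((measurable_state n).prodMk (measurable_state (n + 1))))).1 h
  filter_upwards [h'] with ω hω
  by_contra hc
  have : ((ω n).1, (ω (n + 1)).1) ∈ R := hc
  simp [this] at hω

/-- Markov's inequality at level 1/C, which is exceeded with probability exp(-r/C) ≥ exp(-1). The
sharp constant 1/C is not needed. -/
theorem le_lintegral_expMeasure {r C : ℝ} (hr : 0 < r) (hC : r ≤ C) :
    ENNReal.ofReal (Real.exp (-1) / C) ≤ ∫⁻ t, ENNReal.ofReal t ∂(expMeasure r) := by
  have hC0 : 0 < C := hr.trans_le hC
  have := isProbabilityMeasure_expMeasure hr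
  have h1 : ENNReal.ofReal (Real.exp (-1)) ≤ expMeasure r (Set.Ioi (1 / C)) := by
    rw [← Set.compl_Iic, prob_compl_eq_one_sub measurableSet_Iic, ← ofReal_cdf,
      cdf_expMeasure_eq hr, if_pos (by positivity), ← ENNReal.ofReal_one,
      ← ENNReal.ofReal_sub]
    · refine ENNReal.ofReal_le_ofReal ?_
      rw [sub_sub_cancel]
      refine Real.exp_le_exp.2 (neg_le_neg ?_)
      rw [mul_one_div]
      exact (div_le_one hC0).2 hC
    · rw [sub_nonneg, Real.exp_le_one_iff, neg_nonpos]
      positivity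
  calc ENNReal.ofReal (Real.exp (-1) / C)
      = ENNReal.ofReal (1 / C) * ENNReal.ofReal (Real.exp (-1)) := by
        rw [← ENNReal.ofReal_mul (by positivity)]; ring_nf
    _ ≤ ENNReal.ofReal (1 / C) * expMeasure r (Set.Ioi (1 / C)) := by gcongr
    _ ≤ ENNReal.ofReal (1 / C) * expMeasure r {t | ENNReal.ofReal (1 / C) ≤ ENNReal.ofReal t} := by
        gcongr
        intro t ht
        exact ENNReal.ofReal_le_ofReal (le_of_lt ht)
    _ ≤ _ := mul_meas_ge_le_lintegral₀ (by fun_prop) _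

end Network
end RandomAccess
end

/-! ### Positive drift and infinite mean return times -/

noncomputable section

namespace RandomAccess

namespace Network

variable {V : Type}

open Classical in
-- The increments telescope until the return. At the return `f` has its starting value again, so the
-- stopped sum closes up to 0 and stays there.
theorem sum_indicator_increments {N : Network V} {f : N.State → ℝ} (B : Set N.State) {ω : N.Sample} {z : N.State}
    (h0 : (ω 0).1 = z) (hf : ∀ y ∈ B, f y = f z) (n : ℕ) :
    ∑ k ∈ Finset.range n, (if ω ∈ notReturned B k then f (ω (k + 1)).1 - f (ω k).1 else 0) =
      if ω ∈ notReturned B n then f (ω n).1 - f z else 0 := by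
  induction n with
  | zero => simp [h0]
  | succ n ih =>
    rw [Finset.sum_range_succ, ih]
    by_cases h : ω ∈ notReturned B n
    · by_cases h' : ω ∈ notReturned B (n + 1)
      · simp [h, h']
      · have : (ω (n + 1)).1 ∈ B := by
          by_contra hc
          exact h' (mem_notReturned_succ.2 ⟨h, fun hb => absurd hb hc⟩)
        simp [h, h', hf _ this]
    · have h' : ω ∉ notReturned B (n + 1) := fun h' => h (notReturned_anti B n.le_succ h')
      simp [h, h']

variable (N : Network V) [DecidableEq V] [Fintype V] [Nonempty V]

/-- Whether a return has happened by step k + 1 depends on the state at that step but not on its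
holding time, whose conditional mean is bounded below because the total rates are bounded by `C`. -/
theorem le_lintegral_holding {C : ℝ} (hC : ∀ z, N.totalRate z ≤ C) (B : Set N.State)
    (z : N.State) (k : ℕ) :
    ENNReal.ofReal (Real.exp (-1) / C) * N.law z (notReturned B (k + 1)) ≤
      ∫⁻ ω, (notReturned B (k + 1)).indicator (fun ω => ENNReal.ofReal (ω (k + 1)).2) ω
        ∂(N.law z) := by
  classical
  -- The event of no return by step k + 1, written in terms of the past up to k and the next state
  -- alone, as one-step conditioning requires.
  let S : Set (N.Sample × N.State) :=
    {q | q.1 ∈ notReturned B k ∧ (q.2 ∈ B → ∀ m ≤ k, (q.1 m).1 ∈ B)}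
  have hB : MeasurableSet B := (Set.to_countable B).measurableSet
  have hS : MeasurableSet S := by
    have : S = (Prod.fst ⁻¹' notReturned B k) ∩ ((Prod.snd ⁻¹' Bᶜ) ∪
        ⋂ (m : ℕ) (_ : m ≤ k), Prod.fst ⁻¹' {ω : N.Sample | (ω m).1 ∈ B}) := by
      ext q
      simp only [S, Set.mem_ofPred_eq, Set.mem_inter_iff, Set.mem_preimage, Set.mem_union,
        Set.mem_compl_iff, Set.mem_iInter]
      tauto
    rw [this]
    exact (measurable_fst (measurableSet_notReturned B k)).inter
      ((measurable_snd hB.compl).union (.iInter fun m => .iInter fun _ =>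
        measurable_fst (measurableSet_state m B)))
  have hmem : ∀ ω : N.Sample, (ω, (ω (k + 1)).1) ∈ S ↔ ω ∈ notReturned B (k + 1) :=
    fun ω => mem_notReturned_succ.symm
  have hSdep : ∀ (ω ω' : N.Sample), (∀ m ≤ k, ω m = ω' m) → ∀ y, (ω, y) ∈ S ↔ (ω', y) ∈ S := by
    intro ω ω' h y
    simp only [S, Set.mem_ofPred_eq, notReturned]
    refine and_congr ?_ (imp_congr_right fun _ => forall₂_congr fun m hm => by rw [h m hm])
    refine forall₂_congr fun m n => forall₂_congr fun hmn hn => ?_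
    rw [h m (by omega), h n hn]
  have hproj : Measurable fun q : N.Sample × (N.State × ℝ) => (q.1, q.2.1) := by fun_prop
  have e1 := N.lintegral_law_succ z k (fun ω y => S.indicator 1 (ω, y.1))
    ((measurable_one.indicator hS).comp hproj)
    (fun ω ω' h => by
      ext y
      simp only [Set.indicator_apply, hSdep ω ω' h, Pi.one_apply])
  have e2 := N.lintegral_law_succ z k
    (fun ω y => S.indicator 1 (ω, y.1) * ENNReal.ofReal y.2)
    (((measurable_one.indicator hS).comp hproj).mul (by fun_prop))
    (fun ω ω' h => by
      ext y
      simp only [Set.indicator_apply, hSdep ω ω' h, Pi.one_apply])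
  have e3 : N.law z (notReturned B (k + 1)) =
      ∫⁻ ω, S.indicator 1 (ω, (ω (k + 1)).1) ∂(N.law z) := by
    rw [← lintegral_indicator_one (measurableSet_notReturned B (k + 1))]
    refine lintegral_congr fun ω => ?_
    simp only [Set.indicator_apply, hmem, Pi.one_apply]
  have e4 : ∀ ω : N.Sample,
      (notReturned B (k + 1)).indicator (fun ω => ENNReal.ofReal (ω (k + 1)).2) ω =
      S.indicator 1 (ω, (ω (k + 1)).1) * ENNReal.ofReal (ω (k + 1)).2 := by
    intro ω
    simp only [Set.indicator_apply, hmem]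
    split_ifs <;> simp
  simp only [e4]
  rw [e2, e3, e1, ← lintegral_const_mul' _ _ ENNReal.ofReal_ne_top]
  refine lintegral_mono fun ω => ?_
  have hm : Measurable fun y : N.State => S.indicator (1 : N.Sample × N.State → ℝ≥0∞) (ω, y) :=
    (measurable_one.indicator hS).comp measurable_prodMk_left
  rw [N.lintegral_step_state (ω k).1 (fun y => S.indicator 1 (ω, y)) hm,
    N.lintegral_step _ (fun y => S.indicator 1 (ω, y.1) * ENNReal.ofReal y.2)
      ((hm.comp measurable_fst).mul (by fun_prop)), Finset.mul_sum]
  refine Finset.sum_le_sum fun e _ => ?_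
  simp only
  rw [lintegral_const_mul _ (by fun_prop), mul_left_comm]
  gcongr _ * ?_
  rw [mul_comm]
  gcongr
  exact le_lintegral_expMeasure (N.totalRate_pos _) (hC _)

variable {f : N.State → ℝ} {J C ε : ℝ}

/-- The shift by `J` makes the increment nonnegative, so that its mean can be taken in `ℝ≥0∞`.
Dividing the drift by the total rate, at most `C`, gives the mean increment of the jump chain. -/
theorem le_lintegral_step_drift (hC : ∀ z, N.totalRate z ≤ C)
    (hJ : ∀ z e, |f (N.next z e) - f z| ≤ J) (hε : 0 < ε)
    (hdrift : ∀ z, ε ≤ ∑ e, N.rate z e * (f (N.next z e) - f z)) (z : N.State) :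
    ENNReal.ofReal (ε / C + J) ≤ ∫⁻ y, ENNReal.ofReal (f y.1 - f z + J) ∂(N.step z) := by
  have hq := N.totalRate_pos z
  rw [N.lintegral_step_state z (fun y => ENNReal.ofReal (f y - f z + J))
    (measurable_of_countable _)]
  simp_rw [← ENNReal.ofReal_mul (div_nonneg (N.rate_nonneg z _) hq.le)]
  rw [← ENNReal.ofReal_sum_of_nonneg fun e _ =>
    mul_nonneg (div_nonneg (N.rate_nonneg z _) hq.le) (by linarith [(abs_le.1 (hJ z e)).1])]
  refine ENNReal.ofReal_le_ofReal ?_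
  have : ∑ e, N.rate z e / N.totalRate z * (f (N.next z e) - f z + J) =
      (∑ e, N.rate z e * (f (N.next z e) - f z)) / N.totalRate z + J := by
    simp_rw [mul_add, Finset.sum_add_distrib, ← Finset.sum_mul, ← Finset.sum_div]
    have h1 : ∑ e, N.rate z e = N.totalRate z := rfl
    rw [h1, div_self hq.ne', one_mul, Finset.sum_div]
    congr 1
    exact Finset.sum_congr rfl fun e _ => by ring
  rw [this]
  gcongr ?_ + J
  exact div_le_div₀ (hε.le.trans (hdrift z)) (hdrift z) hq (hC z)

/-- Optional stopping at the return: each step before it contributes at least ε/C in the mean, while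
the stopped sum vanishes after a return and is at most `n * J` otherwise. -/
theorem sum_measure_notReturned_le (hC : ∀ z, N.totalRate z ≤ C)
    (hJ : ∀ z e, |f (N.next z e) - f z| ≤ J) (hJ0 : 0 ≤ J) (hε : 0 < ε)
    (hdrift : ∀ z, ε ≤ ∑ e, N.rate z e * (f (N.next z e) - f z)) (B : Set N.State) (z : N.State)
    (hf : ∀ y ∈ B, f y = f z) (n : ℕ) :
    ε / C * ∑ k ∈ Finset.range n, (N.law z).real (notReturned B k) ≤
      n * J * (N.law z).real (notReturned B n) := by
  classical
  have hC0 : 0 < C := (N.totalRate_pos z).trans_le (hC z)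
  have hmeas : ∀ k : ℕ, Measurable fun ω : N.Sample =>
      ENNReal.ofReal (f (ω (k + 1)).1 - f (ω k).1 + J) := fun k => by
    have hf : Measurable f := measurable_of_countable _
    have h1 := hf.comp (measurable_state (N := N) k)
    have h2 := hf.comp (measurable_state (N := N) (k + 1))
    exact ENNReal.measurable_ofReal.comp ((h2.sub h1).add_const J)
  have lower : ∀ k, ENNReal.ofReal (ε / C + J) * N.law z (notReturned B k) ≤
      ∫⁻ ω, (notReturned B k).indicator
        (fun ω => ENNReal.ofReal (f (ω (k + 1)).1 - f (ω k).1 + J)) ω ∂(N.law z) := by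
    intro k
    have hA := measurableSet_notReturned B k
    have e := N.lintegral_law_succ z k
      (fun ω y => (notReturned B k).indicator 1 ω * ENNReal.ofReal (f y.1 - f (ω k).1 + J))
      (by
        have hf : Measurable f := measurable_of_countable _
        have h1 := (hf.comp (measurable_state (N := N) k)).comp
          (measurable_fst : Measurable (Prod.fst : N.Sample × (N.State × ℝ) → _))
        have h2 := (hf.comp measurable_fst).comp
          (measurable_snd : Measurable (Prod.snd : N.Sample × (N.State × ℝ) → _))
        exact ((measurable_one.indicator hA).comp measurable_fst).mul
          (ENNReal.measurable_ofReal.comp ((h2.sub h1).add_const J)))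
      (fun ω ω' h => by
        ext y
        have : ω ∈ notReturned B k ↔ ω' ∈ notReturned B k := by
          refine forall₂_congr fun m n => forall₂_congr fun hmn hn => ?_
          rw [h m (by omega), h n hn]
        simp only [Set.indicator_apply, this, h k le_rfl, Pi.one_apply])
    have e4 : ∀ ω : N.Sample, (notReturned B k).indicator
        (fun ω => ENNReal.ofReal (f (ω (k + 1)).1 - f (ω k).1 + J)) ω =
        (notReturned B k).indicator 1 ω * ENNReal.ofReal (f (ω (k + 1)).1 - f (ω k).1 + J) := by
      intro ω
      simp only [Set.indicator_apply]
      split_ifs <;> simp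
    simp only [e4]
    rw [e, ← lintegral_indicator_one hA, ← lintegral_const_mul' _ _ ENNReal.ofReal_ne_top]
    refine lintegral_mono fun ω => ?_
    have hm : Measurable fun y : N.State × ℝ => ENNReal.ofReal (f y.1 - f (ω k).1 + J) :=
      (measurable_of_countable fun y => ENNReal.ofReal (f y - f (ω k).1 + J)).comp measurable_fst
    simp only
    rw [lintegral_const_mul _ hm, mul_comm]
    gcongr
    exact N.le_lintegral_step_drift hC hJ hε hdrift _
  have upper : ∀ᵐ ω ∂(N.law z), ∑ k ∈ Finset.range n, (notReturned B k).indicator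
        (fun ω => ENNReal.ofReal (f (ω (k + 1)).1 - f (ω k).1 + J)) ω ≤
      (∑ k ∈ Finset.range n, ENNReal.ofReal J * (notReturned B k).indicator 1 ω) +
        ENNReal.ofReal (n * J) * (notReturned B n).indicator 1 ω := by
    filter_upwards [N.law_start z, N.law_next z] with ω h0 hn
    have hinc : ∀ k, |f (ω (k + 1)).1 - f (ω k).1| ≤ J := fun k => by
      obtain ⟨e, he⟩ := hn k
      rw [he]; exact hJ _ e
    have hbound : ∀ m : ℕ, f (ω m).1 - f z ≤ m * J := by
      intro m
      induction m with
      | zero => simp [h0]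
      | succ m ih => push_cast; linarith [(abs_le.1 (hinc m)).2]
    have t1 : ∀ k, (notReturned B k).indicator
        (fun ω => ENNReal.ofReal (f (ω (k + 1)).1 - f (ω k).1 + J)) ω =
        ENNReal.ofReal ((if ω ∈ notReturned B k then f (ω (k + 1)).1 - f (ω k).1 else 0) +
          J * if ω ∈ notReturned B k then 1 else 0) := by
      intro k
      simp only [Set.indicator_apply]
      split_ifs <;> simp
    have t2 : ∀ k (a : ℝ), 0 ≤ a → ENNReal.ofReal a * (notReturned B k).indicator 1 ω =
        ENNReal.ofReal (a * if ω ∈ notReturned B k then 1 else 0) := by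
      intro k a _
      simp only [Set.indicator_apply]
      split_ifs <;> simp
    simp only [t1, t2 _ _ hJ0, t2 _ (n * J) (by positivity)]
    rw [← ENNReal.ofReal_sum_of_nonneg, ← ENNReal.ofReal_sum_of_nonneg, ← ENNReal.ofReal_add]
    · refine ENNReal.ofReal_le_ofReal ?_
      rw [Finset.sum_add_distrib, sum_indicator_increments B h0 hf n, add_comm]
      gcongr
      split_ifs
      · simpa using hbound n
      · simp
    · exact Finset.sum_nonneg fun k _ => by positivity
    · positivity
    · exact fun k _ => by positivity
    · intro k _
      split_ifs
      · linarith [(abs_le.1 (hinc k)).1]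
      · simp
  -- The shift by `J` adds the same finite sum to both sides; it cancels once the inequality is
  -- moved to `ℝ`.
  have main : ENNReal.ofReal (ε / C + J) * ∑ k ∈ Finset.range n, N.law z (notReturned B k) ≤
      ENNReal.ofReal J * (∑ k ∈ Finset.range n, N.law z (notReturned B k)) +
        ENNReal.ofReal (n * J) * N.law z (notReturned B n) := by
    have hind : ∀ k, Measurable ((notReturned B k).indicator (1 : N.Sample → ℝ≥0∞)) := fun k =>
      measurable_one.indicator (measurableSet_notReturned B k)
    calc _ = ∑ k ∈ Finset.range n, ENNReal.ofReal (ε / C + J) * N.law z (notReturned B k) :=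
          Finset.mul_sum ..
      _ ≤ ∑ k ∈ Finset.range n, ∫⁻ ω, (notReturned B k).indicator
          (fun ω => ENNReal.ofReal (f (ω (k + 1)).1 - f (ω k).1 + J)) ω ∂(N.law z) :=
          Finset.sum_le_sum fun k _ => lower k
      _ = ∫⁻ ω, ∑ k ∈ Finset.range n, (notReturned B k).indicator
          (fun ω => ENNReal.ofReal (f (ω (k + 1)).1 - f (ω k).1 + J)) ω ∂(N.law z) :=
          (lintegral_finsetSum _ fun k _ =>
            (hmeas k).indicator (measurableSet_notReturned B k)).symm
      _ ≤ _ := lintegral_mono_ae upper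
      _ = _ := by
        rw [lintegral_add_right _ ((hind n).const_mul _),
          lintegral_finsetSum _ fun k _ => (hind k).const_mul _,
          lintegral_const_mul _ (hind n), lintegral_indicator_one (measurableSet_notReturned B n),
          Finset.mul_sum]
        congr 1
        refine Finset.sum_congr rfl fun k _ => ?_
        rw [lintegral_const_mul _ (hind k), lintegral_indicator_one (measurableSet_notReturned B k)]
  have hreal : ∀ k, N.law z (notReturned B k) =
      ENNReal.ofReal ((N.law z).real (notReturned B k)) := fun k => by simp
  simp only [hreal] at main
  rw [← ENNReal.ofReal_sum_of_nonneg fun _ _ => measureReal_nonneg,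
    ← ENNReal.ofReal_mul (by positivity), ← ENNReal.ofReal_mul hJ0,
    ← ENNReal.ofReal_mul (by positivity), ← ENNReal.ofReal_add
      (mul_nonneg hJ0 (Finset.sum_nonneg fun _ _ => measureReal_nonneg)) (by positivity),
    ENNReal.ofReal_le_ofReal_iff (add_nonneg
      (mul_nonneg hJ0 (Finset.sum_nonneg fun _ _ => measureReal_nonneg)) (by positivity))] at main
  linarith

/-- If a function that is constant on `B` has bounded jumps and a drift bounded below by a positive
constant, then the mean return time to `B` is infinite. -/
theorem lintegral_returnTime_eq_top (hC : ∀ z, N.totalRate z ≤ C)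
    (hJ : ∀ z e, |f (N.next z e) - f z| ≤ J) (hJ0 : 0 < J) (hε : 0 < ε)
    (hdrift : ∀ z, ε ≤ ∑ e, N.rate z e * (f (N.next z e) - f z)) (B : Set N.State) (z : N.State)
    (hf : ∀ y ∈ B, f y = f z) : ∫⁻ ω, returnTime B ω ∂(N.law z) = ∞ := by
  by_contra hfin
  have hC0 : 0 < C := (N.totalRate_pos z).trans_le (hC z)
  set a : ℕ → ℝ := fun k => (N.law z).real (notReturned B k) with ha
  have ha0 : ∀ k, 0 ≤ a k := fun k => measureReal_nonneg
  set δ : ℝ := Real.exp (-1) / C with hδ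
  have hδ0 : 0 < δ := by positivity
  -- Every step without a return costs mean time at least `δ`, so a finite mean return time bounds
  -- the sum. The bound on holding times starts at index 1, hence the index shift.
  have hsum : Summable a := by
    rw [← summable_nat_add_iff 1]
    refine summable_of_sum_range_le (c := (∫⁻ ω, returnTime B ω ∂(N.law z)).toReal / δ)
      (fun k => ha0 _) fun n => ?_
    rw [le_div_iff₀ hδ0, ← ENNReal.ofReal_le_iff_le_toReal hfin, mul_comm,
      ENNReal.ofReal_mul hδ0.le, ENNReal.ofReal_sum_of_nonneg fun _ _ => ha0 _, Finset.mul_sum]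
    have hreal : ∀ k, ENNReal.ofReal (a k) = N.law z (notReturned B k) := fun k => by simp [ha]
    simp only [hreal]
    have hm : ∀ k : ℕ, Measurable ((notReturned B k).indicator
        fun ω : N.Sample => ENNReal.ofReal (ω k).2) := fun k =>
      Measurable.indicator (by fun_prop) (measurableSet_notReturned B k)
    calc _ ≤ ∑ k ∈ Finset.range n, ∫⁻ ω, (notReturned B (k + 1)).indicator
          (fun ω => ENNReal.ofReal (ω (k + 1)).2) ω ∂(N.law z) :=
          Finset.sum_le_sum fun k _ => N.le_lintegral_holding hC B z k
      _ ≤ ∑ k ∈ Finset.range (n + 1), ∫⁻ ω, (notReturned B k).indicator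
          (fun ω => ENNReal.ofReal (ω k).2) ω ∂(N.law z) := by
          rw [Finset.sum_range_succ']
          exact le_self_add
      _ = ∫⁻ ω, ∑ k ∈ Finset.range (n + 1), (notReturned B k).indicator
          (fun ω => ENNReal.ofReal (ω k).2) ω ∂(N.law z) :=
          (lintegral_finsetSum _ fun k _ => hm k).symm
      _ ≤ _ := lintegral_mono fun ω => sum_notReturned_le_returnTime B ω (n + 1)
  have hone : a 0 = 1 := by
    have : notReturned B 0 = (Set.univ : Set N.Sample) := by
      ext ω
      simp only [notReturned, Set.mem_ofPred_eq, Set.mem_univ, iff_true]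
      intro m n hmn hn
      omega
    simp [ha, this]
  -- The sum in the drift inequality contains the term `a 0 = 1`, so `a n` dominates a multiple of
  -- the harmonic series.
  have hlow : ∀ n : ℕ, ε / C / J * (1 / n) ≤ a n := by
    intro n
    rcases Nat.eq_zero_or_pos n with rfl | hn
    · simpa using ha0 0
    · have h1 := N.sum_measure_notReturned_le hC hJ hJ0.le hε hdrift B z hf n
      have h2 : (1 : ℝ) ≤ ∑ k ∈ Finset.range n, a k := by
        rw [← hone]
        exact Finset.single_le_sum (fun k _ => ha0 k) (Finset.mem_range.2 hn)
      have hn' : (0 : ℝ) < n := by exact_mod_cast hn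
      have h3 : ε / C ≤ n * J * a n := by
        refine le_trans ?_ h1
        exact le_mul_of_one_le_right (by positivity) h2
      rw [div_mul_div_comm, mul_one, div_le_iff₀ (by positivity)]
      linarith
  have : Summable fun n : ℕ => ε / C / J * (1 / (n : ℝ)) :=
    Summable.of_nonneg_of_le (fun n => by positivity) hlow hsum
  exact Real.not_summable_one_div_natCast
    ((summable_mul_left_iff (by positivity : ε / C / J ≠ 0)).1 this)

end Network
end RandomAccess
end

/-! ### The activity process: reversibility and the Poisson equation -/

noncomputable section

namespace RandomAccess

theorem sum_event {V : Type} [Fintype V] (F : Event V → ℝ) :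
    ∑ e, F e = ∑ i, (F (.arrival i) + F (.activation i) + F (.backoff i) +
      F (.nextTransmission i)) := by
  rw [← (Event.equiv V).symm.sum_comp F]
  simp only [Fintype.sum_sum_type, Finset.sum_add_distrib, Event.equiv, Equiv.coe_fn_symm_mk]
  ring

namespace Network

variable {V : Type} (N : Network V)

/-- The stationary (product-form) weight of an activity state. -/
def weight (x : N.Activity) : ℝ := ∏ i ∈ x.1, N.nu i / (N.p i * N.mu i)

theorem weight_pos (x : N.Activity) : 0 < N.weight x :=
  Finset.prod_pos fun i _ => div_pos (N.nu_pos i) (mul_pos (N.p_pos i) (N.mu_pos i))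

/-- The state without active nodes. -/
def idle : N.Activity := ⟨∅, by simp⟩

variable [DecidableEq V]

theorem unblocked_deactivate {y : N.Activity} {i : V} (hi : i ∈ y.1) :
    N.Unblocked (N.deactivate y i) i := by
  refine ⟨by simp [deactivate], fun j hj => ?_⟩
  simp only [deactivate, Finset.mem_erase] at hj
  exact y.2 hi hj.2 (Ne.symm hj.1)

theorem activate_deactivate {y : N.Activity} {i : V} (hi : i ∈ y.1)
    (h : N.Unblocked (N.deactivate y i) i) : N.activate (N.deactivate y i) i h = y :=
  Subtype.ext (Finset.insert_erase hi)

theorem deactivate_activate {x : N.Activity} {i : V} (h : N.Unblocked x i) :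
    N.deactivate (N.activate x i h) i = x :=
  Subtype.ext (Finset.erase_insert h.1)

theorem weight_activate {x : N.Activity} {i : V} (h : N.Unblocked x i) :
    N.weight (N.activate x i h) * (N.p i * N.mu i) = N.weight x * N.nu i := by
  have h1 := N.p_pos i
  have h2 := N.mu_pos i
  simp only [weight, activate]
  rw [Finset.prod_insert h.1]
  field_simp

theorem rate_eq (z : N.State) (e : Event V) : N.rate z e = N.rate (z.1, 0) e := by
  cases e <;> rfl

theorem next_fst_eq (z : N.State) (e : Event V) : (N.next z e).1 = (N.next (z.1, 0) e).1 := by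
  cases e <;> simp only [next] <;> split_ifs <;> rfl

theorem abs_next_snd_sub_le (z : N.State) (e : Event V) (i : V) :
    |((N.next z e).2 i : ℝ) - z.2 i| ≤ 1 := by
  have hadd : ∀ j, |(addPacket z.2 j i : ℝ) - z.2 i| ≤ 1 := by
    intro j
    by_cases h : i = j
    · subst h; simp [addPacket]
    · simp [addPacket, Function.update_of_ne h]
  have hrem : ∀ j, |(removePacket z.2 j i : ℝ) - z.2 i| ≤ 1 := by
    intro j
    by_cases h : i = j
    · subst h
      rcases Nat.eq_zero_or_pos (z.2 i) with h0 | h0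
      · simp [removePacket, h0]
      · simp [removePacket, Nat.cast_sub (Nat.succ_le_of_lt h0)]
    · simp [removePacket, Function.update_of_ne h]
  cases e <;> simp only [next]
  · exact hadd _
  all_goals split_ifs
  all_goals first | exact hrem _ | simp

theorem neg_one_le_removePacket (Q : V → ℕ) (j i : V) :
    (if j = i then -1 else 0) ≤ (removePacket Q j i : ℝ) - Q i := by
  split_ifs with h
  · subst h
    rcases Nat.eq_zero_or_pos (Q j) with h0 | h0
    · simp [removePacket, h0]
    · simp [removePacket, Nat.cast_sub (Nat.succ_le_of_lt h0)]
  · simp [removePacket, Function.update_of_ne (Ne.symm h)]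

variable [Fintype V]

instance : Fintype N.Activity := Fintype.ofFinite _

open Classical in
/-- Detailed balance for the activity process. -/
theorem detailed_balance (i : V) (F : N.Activity → N.Activity → ℝ) :
    ∑ x, N.weight x * (if h : N.Unblocked x i then N.nu i * F x (N.activate x i h) else 0) =
      ∑ y, N.weight y * (if i ∈ y.1 then N.p i * N.mu i * F (N.deactivate y i) y else 0) := by
  have h1 : ∀ x : N.Activity,
      N.weight x * (if h : N.Unblocked x i then N.nu i * F x (N.activate x i h) else 0) ≠ 0 →
      N.Unblocked x i := fun x hx => by
    by_contra hc
    simp [hc] at hx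
  have h2 : ∀ y : N.Activity,
      N.weight y * (if i ∈ y.1 then N.p i * N.mu i * F (N.deactivate y i) y else 0) ≠ 0 →
      i ∈ y.1 := fun y hy => by
    by_contra hc
    simp [hc] at hy
  -- Activating i is a bijection from the states in which i is unblocked to those in which i is
  -- active. Restricting to nonzero terms supplies the proof that i is unblocked.
  refine Finset.sum_bij_ne_zero (fun x _ hx => N.activate x i (h1 x hx)) (fun _ _ _ => by simp)
    (fun x _ hx y _ hy hxy => ?_) (fun y _ hy => ?_) (fun x _ hx => ?_)
  · rw [← N.deactivate_activate (h1 x hx), hxy, N.deactivate_activate]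
  · have hu := N.unblocked_deactivate (h2 y hy)
    have ha := N.activate_deactivate (h2 y hy) hu
    refine ⟨N.deactivate y i, Finset.mem_univ _, ?_, ha⟩
    rw [dif_pos hu, ha, ← mul_assoc, ← N.weight_activate hu, ha, mul_assoc]
    rwa [if_pos (h2 y hy)] at hy
  · have hu := h1 x hx
    have hm : i ∈ (N.activate x i hu).1 := Finset.mem_insert_self _ _
    rw [dif_pos hu, if_pos hm, N.deactivate_activate, ← mul_assoc, ← mul_assoc,
      N.weight_activate hu]

/-- The generator of the activity process, as a linear map on functions. -/
def generator : (N.Activity → ℝ) →ₗ[ℝ] (N.Activity → ℝ) where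
  toFun h x := ∑ e, N.rate (x, 0) e * (h (N.next (x, 0) e).1 - h x)
  map_add' h g := by
    ext x
    simp only [Pi.add_apply, ← Finset.sum_add_distrib]
    exact Finset.sum_congr rfl fun e _ => by ring
  map_smul' c h := by
    ext x
    simp only [Pi.smul_apply, smul_eq_mul, RingHom.id_apply, Finset.mul_sum]
    exact Finset.sum_congr rfl fun e _ => by ring

open Classical in
-- Detailed balance turns each back-off term into the reversed activation term, so the sum runs over
-- undirected edges. Arrivals and immediate next transmissions keep the activity state and drop out
-- by `hF`.
theorem sum_weight_mul_sum_rate (F : N.Activity → N.Activity → ℝ) (hF : ∀ x, F x x = 0) :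
    ∑ x, N.weight x * ∑ e, N.rate (x, 0) e * F x (N.next (x, 0) e).1 =
      ∑ i, ∑ x, N.weight x * (if h : N.Unblocked x i then
        N.nu i * (F x (N.activate x i h) + F (N.activate x i h) x) else 0) := by
  have e1 : ∀ x i, N.rate (x, 0) (.arrival i) * F x (N.next (x, 0) (.arrival i)).1 +
      N.rate (x, 0) (.activation i) * F x (N.next (x, 0) (.activation i)).1 +
      N.rate (x, 0) (.backoff i) * F x (N.next (x, 0) (.backoff i)).1 +
      N.rate (x, 0) (.nextTransmission i) * F x (N.next (x, 0) (.nextTransmission i)).1 =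
      (if h : N.Unblocked x i then N.nu i * F x (N.activate x i h) else 0) +
      (if i ∈ x.1 then N.p i * N.mu i * F x (N.deactivate x i) else 0) := by
    intro x i
    simp only [rate, next]
    split_ifs <;> simp [hF]
  simp only [sum_event, e1, Finset.mul_sum, mul_add]
  rw [Finset.sum_comm]
  refine Finset.sum_congr rfl fun i _ => ?_
  rw [Finset.sum_add_distrib, ← N.detailed_balance i (fun x y => F y x), ← Finset.sum_add_distrib]
  refine Finset.sum_congr rfl fun x _ => ?_
  split_ifs <;> ring

theorem sum_weight_mul_generator (h : N.Activity → ℝ) :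
    ∑ x, N.weight x * N.generator h x = 0 := by
  classical
  refine (N.sum_weight_mul_sum_rate (fun x y => h y - h x) (fun x => sub_self _)).trans ?_
  refine Finset.sum_eq_zero fun i _ => Finset.sum_eq_zero fun x _ => ?_
  split_ifs <;> ring

/-- Dirichlet form: pairing `h` with its generator gives minus a weighted sum of squared differences
over activations. All of these vanish, and every state is built from the idle one by activations. -/
theorem eq_idle_of_generator_eq_zero {h : N.Activity → ℝ} (h0 : N.generator h = 0)
    (x : N.Activity) : h x = h N.idle := by
  classical
  have key := N.sum_weight_mul_sum_rate (fun x y => h x * (h y - h x)) (fun x => by ring)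
  have hl : ∑ x, N.weight x * ∑ e, N.rate (x, 0) e * (h x * (h (N.next (x, 0) e).1 - h x)) = 0 := by
    refine Finset.sum_eq_zero fun x _ => ?_
    have : N.generator h x = 0 := by rw [h0]; rfl
    have h2 : ∑ e, N.rate (x, 0) e * (h x * (h (N.next (x, 0) e).1 - h x)) =
        h x * N.generator h x := by
      change _ = h x * ∑ e, N.rate (x, 0) e * (h (N.next (x, 0) e).1 - h x)
      rw [Finset.mul_sum]
      exact Finset.sum_congr rfl fun e _ => by ring
    rw [h2, this, mul_zero, mul_zero]
  simp only [hl] at key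
  have key2 : ∑ i, ∑ x, N.weight x * (if hu : N.Unblocked x i then
      N.nu i * (h (N.activate x i hu) - h x) ^ 2 else 0) = 0 := by
    refine neg_eq_zero.1 (Eq.trans ?_ key.symm)
    rw [← Finset.sum_neg_distrib]
    refine Finset.sum_congr rfl fun i _ => ?_
    rw [← Finset.sum_neg_distrib]
    refine Finset.sum_congr rfl fun x _ => ?_
    split_ifs <;> ring
  have hnn : ∀ i x, 0 ≤ N.weight x * (if hu : N.Unblocked x i then
      N.nu i * (h (N.activate x i hu) - h x) ^ 2 else 0) := fun i x => by
    have := N.weight_pos x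
    have := N.nu_pos i
    split_ifs <;> positivity
  have hstep : ∀ i x (hu : N.Unblocked x i), h (N.activate x i hu) = h x := by
    intro i x hu
    have a1 := (Finset.sum_eq_zero_iff_of_nonneg fun i _ =>
      Finset.sum_nonneg fun x _ => hnn i x).1 key2 i (Finset.mem_univ _)
    have a2 := (Finset.sum_eq_zero_iff_of_nonneg fun x _ => hnn i x).1 a1 x (Finset.mem_univ _)
    rw [dif_pos hu] at a2
    simpa [(N.weight_pos x).ne', (N.nu_pos i).ne', sub_eq_zero] using a2
  obtain ⟨s, hs⟩ := x
  induction s using Finset.induction_on with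
  | empty => rfl
  | insert i s hi ih =>
    set y : N.Activity := ⟨insert i s, hs⟩
    have hy : i ∈ y.1 := Finset.mem_insert_self _ _
    have hu := N.unblocked_deactivate hy
    rw [← N.activate_deactivate hy hu, hstep]
    have hs' : N.graph.IsIndepSet (s : Set V) := hs.mono (by simp)
    have : N.deactivate y i = ⟨s, hs'⟩ := Subtype.ext (Finset.erase_insert hi)
    rw [this]
    exact ih hs'

/-- The Poisson equation of the activity process is solvable for centered right-hand sides. -/
theorem exists_generator_eq {g : N.Activity → ℝ} (hg : ∑ x, N.weight x * g x = 0) :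
    ∃ h, N.generator h = g := by
  let φ : (N.Activity → ℝ) →ₗ[ℝ] ℝ := ∑ x, N.weight x • LinearMap.proj x
  have hφ : ∀ u, φ u = ∑ x, N.weight x * u x := fun u => by simp [φ]
  -- A rank-one perturbation removes the constants from the kernel. Since φ annihilates the range of
  -- the generator, φ(T u) = -Z φ(u) with Z the total weight; so `T` is injective, hence surjective,
  -- and a preimage of a centered function is itself centered.
  let T : (N.Activity → ℝ) →ₗ[ℝ] (N.Activity → ℝ) :=
    N.generator - φ.smulRight (fun _ => (1 : ℝ))
  have hT : ∀ u x, T u x = N.generator u x - φ u := fun u x => by simp [T]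
  have hZ : 0 < ∑ x, N.weight x :=
    Finset.sum_pos (fun x _ => N.weight_pos x) ⟨N.idle, Finset.mem_univ _⟩
  have hφT : ∀ u, φ (T u) = -(φ u * ∑ x, N.weight x) := by
    intro u
    rw [hφ]
    simp only [hT, mul_sub, Finset.sum_sub_distrib, N.sum_weight_mul_generator, ← Finset.sum_mul]
    ring
  have hzero : ∀ u, φ (T u) = 0 → φ u = 0 := by
    intro u hu
    rw [hφT, neg_eq_zero] at hu
    exact (mul_eq_zero.1 hu).resolve_right hZ.ne'
  have hinj : Function.Injective T := by
    rw [← LinearMap.ker_eq_bot, LinearMap.ker_eq_bot']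
    intro u hu
    have h1 : φ u = 0 := hzero u (by rw [hu, map_zero])
    have h2 : N.generator u = 0 := by
      ext x
      have := congrFun hu x
      rw [hT, h1, sub_zero] at this
      exact this
    have h3 := N.eq_idle_of_generator_eq_zero h2
    rw [hφ] at h1
    simp only [fun x => h3 x, ← Finset.sum_mul] at h1
    ext x
    rw [h3 x]
    exact (mul_eq_zero.1 h1).resolve_left hZ.ne'
  obtain ⟨u, hu⟩ := LinearMap.injective_iff_surjective.1 hinj g
  refine ⟨u, ?_⟩
  have h1 : φ u = 0 := hzero u (by rw [hu, hφ, hg])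
  ext x
  rw [← hu, hT, h1, sub_zero]

/-! ### Throughput and the stability bound -/

/-- The stationary weight of the states in which node `i` is active. -/
def activeWeight (i : V) : ℝ := by
  classical exact ∑ x, N.weight x * if i ∈ x.1 then 1 else 0

open Classical in
theorem sum_weight_unblocked (i : V) :
    N.nu i * ∑ x, N.weight x * (if N.Unblocked x i then 1 else 0) =
      N.p i * N.mu i * N.activeWeight i := by
  have h := N.detailed_balance i (fun _ _ => 1)
  simp only [mul_one, dite_eq_ite] at h
  simp only [activeWeight, Finset.mul_sum]
  calc _ = _ := Finset.sum_congr rfl fun x _ => by split_ifs <;> ring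
    _ = _ := h
    _ = _ := Finset.sum_congr rfl fun x _ => by split_ifs <;> ring

open Classical in
/-- The rate at which packets leave the queue at `i`, if it is not empty. -/
def serviceRate (i : V) (x : N.Activity) : ℝ :=
  (if N.Unblocked x i then N.nu i else 0) + if i ∈ x.1 then (1 - N.p i) * N.mu i else 0

theorem sum_weight_mul_serviceRate (i : V) :
    ∑ x, N.weight x * N.serviceRate i x = N.mu i * N.activeWeight i := by
  classical
  have h1 : ∑ x, N.weight x * N.serviceRate i x =
      N.nu i * ∑ x, N.weight x * (if N.Unblocked x i then 1 else 0) +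
        (1 - N.p i) * N.mu i * N.activeWeight i := by
    simp only [activeWeight, serviceRate, Finset.mul_sum, ← Finset.sum_add_distrib]
    exact Finset.sum_congr rfl fun x _ => by split_ifs <;> ring
  rw [h1, N.sum_weight_unblocked]
  ring

/-- Equality fails only for an empty queue, where a service removes nothing; this can only raise the
drift. -/
theorem le_sum_rate_mul_queue (z : N.State) (i : V) :
    N.lam i - N.serviceRate i z.1 ≤
      ∑ e, N.rate z e * (((N.next z e).2 i : ℝ) - z.2 i) := by
  classical
  have hl : N.lam i - N.serviceRate i z.1 =
      ∑ j, if j = i then N.lam i - N.serviceRate i z.1 else 0 := by simp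
  rw [hl, sum_event]
  refine Finset.sum_le_sum fun j _ => ?_
  have hj := neg_one_le_removePacket z.2 j i
  have hnu := (N.nu_pos j).le
  have hmu : 0 ≤ (1 - N.p j) * N.mu j :=
    mul_nonneg (sub_nonneg.2 (N.p_le_one j)) (N.mu_pos j).le
  have harr : N.lam j * ((addPacket z.2 j i : ℝ) - z.2 i) = if j = i then N.lam i else 0 := by
    split_ifs with h
    · subst h; simp [addPacket]
    · simp [addPacket, Function.update_of_ne (Ne.symm h)]
  have hact : (if j = i then -(if N.Unblocked z.1 i then N.nu i else 0) else 0) ≤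
      N.rate z (.activation j) * (((N.next z (.activation j)).2 i : ℝ) - z.2 i) := by
    simp only [rate, next]
    by_cases h : j = i
    · subst h
      simp only [if_true] at hj ⊢
      split_ifs
      · nlinarith
      · simp
    · simp only [h, if_false] at hj ⊢
      split_ifs
      · exact mul_nonneg hnu hj
      · simp
  have hnext : (if j = i then -(if i ∈ z.1.1 then (1 - N.p i) * N.mu i else 0) else 0) ≤
      N.rate z (.nextTransmission j) *
        (((N.next z (.nextTransmission j)).2 i : ℝ) - z.2 i) := by
    simp only [rate, next]
    by_cases h : j = i
    · subst h
      simp only [if_true] at hj ⊢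
      split_ifs
      · nlinarith
      · simp
    · simp only [h, if_false] at hj ⊢
      split_ifs
      · exact mul_nonneg hmu hj
      · simp
  have hback : N.rate z (.backoff j) * (((N.next z (.backoff j)).2 i : ℝ) - z.2 i) = 0 := by
    simp only [next]
    split_ifs <;> simp
  have harr' : N.rate z (.arrival j) * (((N.next z (.arrival j)).2 i : ℝ) - z.2 i) =
      if j = i then N.lam i else 0 := harr
  rw [hback, harr', serviceRate]
  by_cases h : j = i
  · simp only [h, if_true] at hact hnext ⊢
    linarith
  · simp only [h, if_false] at hact hnext ⊢
    linarith

/-- Two adjacent nodes cannot be active at the same time, and neither is active if one of them is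
unblocked. The inequality is strict if a neighbor of the first node can be active while the second
is not. -/
theorem activeWeight_add_lt {i j k : V} (hij : N.graph.Adj i j) (hik : N.graph.Adj i k)
    (hjk : j ≠ k) :
    N.activeWeight i + N.activeWeight j + N.p i * N.mu i / N.nu i * N.activeWeight i <
      ∑ x, N.weight x := by
  classical
  have h1 : N.p i * N.mu i / N.nu i * N.activeWeight i =
      ∑ x, N.weight x * (if N.Unblocked x i then 1 else 0) := by
    rw [div_mul_eq_mul_div, ← N.sum_weight_unblocked, mul_div_cancel_left₀ _ (N.nu_pos i).ne']
  rw [h1]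
  simp only [activeWeight, ← Finset.sum_add_distrib, ← mul_add]
  -- In the state where only k is active, i and j are inactive and i is blocked by k, so its
  -- positive weight is missing on the left.
  refine Finset.sum_lt_sum (fun x _ => ?_) ⟨⟨{k}, by simp⟩, Finset.mem_univ _, ?_⟩
  · refine mul_le_of_le_one_right (N.weight_pos x).le ?_
    have a1 : i ∈ x.1 → j ∉ x.1 := fun hi hj => x.2 hi hj hij.ne hij
    have a2 : N.Unblocked x i → i ∉ x.1 ∧ j ∉ x.1 := fun hu =>
      ⟨hu.1, fun hj => hu.2 j hj hij⟩
    split_ifs <;> simp_all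
  · have b1 : ¬ N.Unblocked ⟨{k}, by simp⟩ i := fun hu => hu.2 k (by simp) hik
    simp only [b1, if_false, Finset.mem_singleton, hik.ne, hjk, add_zero, mul_zero]
    exact N.weight_pos _

variable [Nonempty V]

/-- A stable queue receives at most as many packets per unit of time as it could serve. -/
theorem QueueStable.lam_mul_le {N : Network V} {i : V} (hs : N.QueueStable i) :
    N.lam i * ∑ x, N.weight x ≤ N.mu i * N.activeWeight i := by
  by_contra! hlt
  have hZ : 0 < ∑ x, N.weight x :=
    Finset.sum_pos (fun x _ => N.weight_pos x) ⟨N.idle, Finset.mem_univ _⟩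
  set c : ℝ := N.mu i * N.activeWeight i / ∑ x, N.weight x with hc
  have hε : 0 < N.lam i - c := by
    rw [sub_pos, hc, div_lt_iff₀ hZ]
    exact hlt
  -- The corrector `h` replaces the fluctuating service rate by its stationary mean `c`, so that the
  -- drift of Q_i + h(X) is at least `N.lam i - c` in every state, not only on average.
  obtain ⟨h, hh⟩ := N.exists_generator_eq (g := fun x => N.serviceRate i x - c) (by
    simp only [mul_sub, Finset.sum_sub_distrib, N.sum_weight_mul_serviceRate, ← Finset.sum_mul]
    rw [hc, mul_div_cancel₀ _ hZ.ne', sub_self])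
  have hH : ∀ x, |h x| ≤ ∑ y, |h y| := fun x =>
    Finset.single_le_sum (f := fun y => |h y|) (fun y _ => abs_nonneg _) (Finset.mem_univ x)
  have htop := N.lintegral_returnTime_eq_top (f := fun z => (z.2 i : ℝ) + h z.1)
    (J := 1 + 2 * ∑ y, |h y|) (C := ∑ x, N.totalRate (x, 0)) (ε := N.lam i - c)
    (fun z => by
      have : N.totalRate z = N.totalRate (z.1, 0) :=
        Finset.sum_congr rfl fun e _ => N.rate_eq z e
      rw [this]
      exact Finset.single_le_sum (f := fun x => N.totalRate (x, 0))
        (fun x _ => (N.totalRate_pos _).le) (Finset.mem_univ z.1))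
    (fun z e => by
      have h1 := abs_le.1 (N.abs_next_snd_sub_le z e i)
      have h2 := abs_le.1 (hH (N.next z e).1)
      have h3 := abs_le.1 (hH z.1)
      rw [abs_le]
      constructor <;> linarith [h1.1, h1.2, h2.1, h2.2, h3.1, h3.2])
    (by positivity) hε
    (fun z => by
      have h1 := N.le_sum_rate_mul_queue z i
      have h2 : ∑ e, N.rate z e * (h (N.next z e).1 - h z.1) = N.serviceRate i z.1 - c := by
        rw [← congrFun hh z.1]
        exact Finset.sum_congr rfl fun e _ => by rw [N.rate_eq z e, N.next_fst_eq z e]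
      calc _ ≤ ∑ e, N.rate z e * (((N.next z e).2 i : ℝ) - z.2 i) +
            ∑ e, N.rate z e * (h (N.next z e).1 - h z.1) := by rw [h2]; linarith
        _ = _ := by
            rw [← Finset.sum_add_distrib]
            exact Finset.sum_congr rfl fun e _ => by ring)
    {y | y.1 = N.idle ∧ y.2 i = (0 : V → ℕ) i} (N.idle, 0)
    (fun y hy => by simp only [hy.1, hy.2])
  exact (hs (N.idle, 0)).ne htop

end Network

/-! ### The toric grid and the conclusion -/

theorem toricGrid_adj_fst {L : ℕ} [NeZero L] (hL : 2 ≤ L) (a b : Fin L) :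
    (toricGrid L).Adj (a, b) (a + 1, b) := by
  obtain ⟨n, rfl⟩ : ∃ n, L = n + 2 := ⟨L - 2, by omega⟩
  simp [toricGrid, SimpleGraph.cycleGraph_adj]

theorem toricGrid_adj_snd {L : ℕ} [NeZero L] (hL : 2 ≤ L) (a b : Fin L) :
    (toricGrid L).Adj (a, b) (a, b + 1) := by
  obtain ⟨n, rfl⟩ : ∃ n, L = n + 2 := ⟨L - 2, by omega⟩
  simp [toricGrid, SimpleGraph.cycleGraph_adj]

end RandomAccess

end

theorem proposition2 (L : ℕ) [NeZero L] (hL : 4 ≤ L) (hL_even : Even L)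
    (lam mu nu p : ℝ) (hlam : 0 < lam) (hmu : 0 < mu) (hnu : 0 < nu) (hp : 0 < p) (hp1 : p ≤ 1)
    (ρ σ : ℝ) (hρ : ρ = 2 * lam / mu) (hσ : σ = nu / (p * mu))
    (hstable : ∀ i : Fin L × Fin L,
      (RandomAccess.toricNetwork L lam mu nu p hlam hmu hnu hp hp1).QueueStable i) :
    ρ < 1 ∧ σ > ρ / (2 * (1 - ρ)) := by
  set N := RandomAccess.toricNetwork L lam mu nu p hlam hmu hnu hp hp1 with hN
  -- Two different neighbors of the origin: the first is paired with it, the second makes the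
  -- inequality strict.
  have hne : ((0 : Fin L) + 1, (0 : Fin L)) ≠ (0, 0 + 1) := by
    obtain ⟨n, rfl⟩ : ∃ n, L = n + 2 := ⟨L - 2, by omega⟩
    simp
  have h1 := N.activeWeight_add_lt (RandomAccess.toricGrid_adj_fst (by omega) 0 0)
    (RandomAccess.toricGrid_adj_snd (by omega) 0 0) hne
  have h2 : lam * ∑ x, N.weight x ≤ mu * N.activeWeight (0, 0) := (hstable (0, 0)).lam_mul_le
  have h3 : lam * ∑ x, N.weight x ≤ mu * N.activeWeight (0 + 1, 0) :=
    (hstable (0 + 1, 0)).lam_mul_le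
  have h1' : N.activeWeight (0, 0) + N.activeWeight (0 + 1, 0) +
    p * mu / nu * N.activeWeight (0, 0) < ∑ x, N.weight x := h1
  set Z := ∑ x, N.weight x
  have hZ : 0 < Z :=
    Finset.sum_pos (fun x _ => N.weight_pos x) ⟨N.idle, Finset.mem_univ _⟩
  have hσ0 : 0 < σ := by rw [hσ]; positivity
  have hinv : p * mu / nu = 1 / σ := by rw [hσ, one_div_div]
  have hρ0 : 0 < ρ := by rw [hρ]; positivity
  have hload : ρ / 2 = lam / mu := by rw [hρ]; ring
  have a1 : ρ / 2 * Z ≤ N.activeWeight (0, 0) := by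
    rw [hload, div_mul_eq_mul_div, div_le_iff₀ hmu]; linarith
  have a2 : ρ / 2 * Z ≤ N.activeWeight (0 + 1, 0) := by
    rw [hload, div_mul_eq_mul_div, div_le_iff₀ hmu]; linarith
  rw [hinv] at h1'
  have a3 : (ρ + 1 / σ * (ρ / 2)) * Z < 1 * Z := by
    have : 1 / σ * (ρ / 2 * Z) ≤ 1 / σ * N.activeWeight (0, 0) := by gcongr
    linarith
  have a4 : ρ + 1 / σ * (ρ / 2) < 1 := lt_of_mul_lt_mul_right a3 hZ.le
  have hlt : ρ < 1 := by
    have : 0 < 1 / σ * (ρ / 2) := by positivity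
    linarith
  refine ⟨hlt, ?_⟩
  rw [gt_iff_lt, div_lt_iff₀ (by linarith)]
  have a5 : 1 / σ * (ρ / 2) < 1 - ρ := by linarith
  rw [one_div_mul_eq_div, div_lt_iff₀ hσ0] at a5
  linarith
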